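/- Let $d\ge 1$ be an integer and $s\ge 1$ a real number; write $s=k+\gamma$ with $k\ge 0$ an integer and $\gamma\in(0,1]$. Let $\mathcal C^s_1$ be the set of $k$ times continuously differentiable functions $f:\mathbb{R}^d\to\mathbb{R}$ with $\|f\|_{\mathcal C^s}\le 1$, where $$\|f\|_{\mathcal C^s}=\max_{0\le j\le k}\ \max_{\omega\in\{1,\dots,d\}^j}\Big\|\frac{\partial^j f}{\partial x_{\omega_1}\cdots\partial x_{\omega_j}}\Big\|_\star$$ and $\|\cdot\|_\star$ is the uniform norm if $j<k$ and the $\gamma$-Hölder constant (with respect to the Euclidean distance) if $j=k$. For probability measures $\nu_0,\nu_1$ on $\mathbb{R}^d$ with bounded support, let $\|\nu_0-\nu_1\|_{\mathcal C^s_1}=\sup_{f\in\mathcal C^s_1}\big|\int f\,d\nu_0-\int f\,d\nu_1\big|$. There is a constant $C=C(d,s)>0$ such that, for every probability measure $\mu$ on $[0,1]^d$, every sequence $(X_k)_{k\ge 0}$ of independent identically distributed random variables of law $\mu$, and every integer $n\ge 2$, the empirical measure $\hat\mu_n=\frac1n\sum_{k=1}^n\delta_{X_k}$ satisfies $$\mathbb{E}\big[\|\hat\mu_n-\mu\|_{\mathcal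 C^s_1}\big]\le C\cdot\begin{cases}\dfrac{1}{\sqrt n} & \text{if } s>d/2,\\[2mm] \dfrac{\log n}{\sqrt n} & \text{if } s=d/2,\\[2mm] \dfrac{1}{n^{s/d}} & \text{if } s<d/2.\end{cases}$$ In particular $C$ does not depend on $\mu$. (The random variable $\|\hat\mu_n-\mu\|_{\mathcal C^s_1}$ is measurable.) -/

import Mathlib

open MeasureTheory ProbabilityTheory
open scoped ENNReal

noncomputable section

/-- The largest integer strictly below `s` (for `s > 0`): the `k` of the decomposition
`s = k + γ` with `γ ∈ (0, 1]`. -/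
def holderOrder (s : ℝ) : ℕ := ⌈s⌉₊ - 1

/-- The exponent `γ = s - k ∈ (0, 1]` of the decomposition `s = k + γ` (for `s > 0`). -/
def holderExponent (s : ℝ) : NNReal := Real.toNNReal (s - holderOrder s)

/-- The iterated partial derivative `∂^j f / ∂x_{ω 0} ⋯ ∂x_{ω (j - 1)}` (only used for functions
of class `C^j`): the `j`-th differential evaluated at vectors of the canonical basis. -/
def iteratedPartial {d j : ℕ} (f : EuclideanSpace ℝ (Fin d) → ℝ) (ω : Fin j → Fin d)
    (x : EuclideanSpace ℝ (Fin d)) : ℝ :=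
  iteratedFDeriv ℝ j f x (fun i => EuclideanSpace.single (ω i) (1 : ℝ))

/-- The (extended) `C^s` norm of a `k` times continuously differentiable function: the maximum, over
`j ≤ k` and all multi-indices of length `j`, of the uniform norm of the partial derivative
if `j < k`, and of its `γ`-Hölder constant (for the Euclidean distance) if `j = k`. -/
def csNorm {d : ℕ} (s : ℝ) (f : EuclideanSpace ℝ (Fin d) → ℝ) : ℝ≥0∞ :=
  ⨆ j ∈ Finset.range (holderOrder s + 1), ⨆ ω : Fin j → Fin d,
    if j < holderOrder s then ⨆ x, ‖iteratedPartial f ω x‖ₑ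
    else eHolderNorm (holderExponent s) (iteratedPartial f ω)

/-- The class `C^s_1` of functions on `ℝ^d` with `C^s` norm at most `1`. -/
def csUnitBall (d : ℕ) (s : ℝ) : Set (EuclideanSpace ℝ (Fin d) → ℝ) :=
  {f | ContDiff ℝ (holderOrder s : ℕ) f ∧ csNorm s f ≤ 1}

/-- `‖ν₀ - ν₁‖_F = sup_{f ∈ F} |ν₀(f) - ν₁(f)|`, with values in `[0, ∞]`. -/
def dualDist {E : Type*} [MeasurableSpace E] (F : Set (E → ℝ)) (ν₀ ν₁ : Measure E) : ℝ≥0∞ :=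
  ⨆ f ∈ F, ENNReal.ofReal |(∫ x, f x ∂ν₀) - ∫ x, f x ∂ν₁|

/-- The empirical measure `(1/n) ∑_{k=1}^n δ_{x_k}`. -/
def empiricalMeasure {E : Type*} [MeasurableSpace E] (x : ℕ → E) (n : ℕ) : Measure E :=
  (n : ℝ≥0∞)⁻¹ • ∑ k ∈ Finset.Icc 1 n, Measure.dirac (x k)

/-- The cube `[0,1]^d`. -/
def unitCube (d : ℕ) : Set (EuclideanSpace ℝ (Fin d)) :=
  {x | ∀ i, x i ∈ Set.Icc (0 : ℝ) 1}

/-- The rate of convergence. -/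
def rate (d : ℕ) (s : ℝ) (n : ℕ) : ℝ :=
  if (d : ℝ) / 2 < s then 1 / Real.sqrt n
  else if s = (d : ℝ) / 2 then Real.log n / Real.sqrt n
  else 1 / (n : ℝ) ^ (s / (d : ℝ))

end

/-! ### Taylor approximation by polynomials -/

/-! Near any point, at distance `r`, a function of the unit ball is a polynomial of degree at most
`k` up to an error of order `r ^ s`. Attach such a polynomial to each dyadic cell and subtract from
it the polynomial of the parent cell. On the cube, this writes `f`, up to a constant, as a
multiscale sum of monomials cut off to cells, with coefficients `O(2^(-js))` at level `j`; stopping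
at level `J` leaves an error `O(2^(-Js))` (`exists_dyadic_decomposition`). These cut-off monomials
do not depend on `f`, so the dual distance is bounded by a weighted sum of finitely many deviations
`|ν₀(φ) - ν₁(φ)|` (`exists_dualDist_le`): the supremum disappears before any expectation is taken.

For one such `φ`, bounded by 1 and supported in a cell `Q`, the expected deviation of the empirical
measure is at most `√(μ(Q)/n)`. By Cauchy–Schwarz over the roughly `2^(jd)` cells, level `j`
contributes `O(√(2^(jd)/n))`, whatever `μ` is. The expectation is thus of order at most `∑_{j ≤ J}
2^(j(d/2 - s)) / √n + 2^(-Js)`. The sum is a convergent geometric series if `s > d/2`, has equal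
terms if `s = d/2`, and is dominated by its last term if `s < d/2`. In the last two cases `2^(Jd)`
is taken comparable to `n`. -/

theorem iteratedDeriv_comp_add_smul {E : Type*} [NormedAddCommGroup E] [NormedSpace ℝ E]
    {f : E → ℝ} {k : ℕ} (hf : ContDiff ℝ k f) (a v : E) {m : ℕ} (hm : m ≤ k) (t : ℝ) :
    iteratedDeriv m (fun r : ℝ => f (a + r • v)) t =
      iteratedFDeriv ℝ m f (a + t • v) (fun _ => v) := by
  induction m generalizing t with
  | zero => simp
  | succ m ih =>
    rw [iteratedDeriv_succ, funext fun t => ih (by omega) t]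
    refine ContDiffAt.deriv_fderiv_add_smul (ContDiff.contDiffAt ?_)
    exact hf.of_le (by exact_mod_cast hm)

/-- Taylor's formula with Lagrange remainder along a segment. -/
theorem exists_taylor_lagrange {E : Type*} [NormedAddCommGroup E] [NormedSpace ℝ E]
    {f : E → ℝ} {k : ℕ} (hf : ContDiff ℝ k f) (a v : E) :
    ∃ t ∈ Set.Icc (0 : ℝ) 1, f (a + v) =
      ∑ m ∈ Finset.range k, (m.factorial : ℝ)⁻¹ * iteratedFDeriv ℝ m f a (fun _ => v) +
        (k.factorial : ℝ)⁻¹ * iteratedFDeriv ℝ k f (a + t • v) (fun _ => v) := by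
  cases k with
  -- For `k = 0` the remainder is `f (a + t • v)` itself, so `t = 1` works.
  | zero => exact ⟨1, by simp, by simp⟩
  | succ n =>
    have hg : ContDiff ℝ (n + 1 : ℕ) (fun r : ℝ => f (a + r • v)) :=
      hf.comp (contDiff_const.add (contDiff_id.smul contDiff_const))
    obtain ⟨t, ht, h⟩ := taylor_mean_remainder_lagrange_iteratedDeriv (n := n)
      (zero_ne_one (α := ℝ)) (by exact_mod_cast hg.contDiffOn (s := Set.uIcc 0 1))
    rw [Set.uIoo_of_le zero_le_one] at ht
    refine ⟨t, Set.Ioo_subset_Icc_self ht, ?_⟩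
    rw [iteratedDeriv_comp_add_smul hf a v le_rfl, taylor_within_apply] at h
    have h0 : ∀ m ∈ Finset.range (n + 1),
        (((m.factorial : ℝ)⁻¹ * (1 - 0) ^ m) •
          iteratedDerivWithin m (fun r : ℝ => f (a + r • v)) (Set.uIcc 0 1) 0) =
        (m.factorial : ℝ)⁻¹ * iteratedFDeriv ℝ m f a (fun _ => v) := by
      intro m hm
      have hm' : m ≤ n + 1 := (Finset.mem_range.1 hm).le
      rw [iteratedDerivWithin_eq_iteratedDeriv (uniqueDiffOn_uIcc zero_ne_one)
        (hg.of_le (by exact_mod_cast hm')).contDiffAt Set.left_mem_uIcc,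
        iteratedDeriv_comp_add_smul hf a v hm']
      simp
    rw [Finset.sum_congr rfl h0] at h
    simp only [one_smul, sub_zero, one_pow, mul_one] at h
    rw [sub_eq_iff_eq_add] at h
    rw [h]
    ring

theorem iteratedFDeriv_apply_eq_sum_iteratedPartial {d m : ℕ}
    (f : EuclideanSpace ℝ (Fin d) → ℝ) (x v : EuclideanSpace ℝ (Fin d)) :
    iteratedFDeriv ℝ m f x (fun _ => v) =
      ∑ ω : Fin m → Fin d, (∏ i, v (ω i)) * iteratedPartial f ω x := by
  have hv : v = ∑ i, v i • EuclideanSpace.single i (1 : ℝ) := by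
    ext j
    simp [Finset.sum_apply, Pi.single_apply]
  conv_lhs => rw [hv]
  rw [ContinuousMultilinearMap.map_sum]
  refine Finset.sum_congr rfl fun ω _ => ?_
  rw [ContinuousMultilinearMap.map_smul_univ]
  rfl

/-- The Taylor polynomial of order `k` at `a`, as a polynomial in the coordinates. -/
noncomputable def taylorMvPolynomial {d : ℕ} (k : ℕ) (f : EuclideanSpace ℝ (Fin d) → ℝ)
    (a : EuclideanSpace ℝ (Fin d)) : MvPolynomial (Fin d) ℝ :=
  ∑ m ∈ Finset.range (k + 1), ∑ ω : Fin m → Fin d,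
    MvPolynomial.C ((m.factorial : ℝ)⁻¹ * iteratedPartial f ω a) *
      ∏ i, (MvPolynomial.X (ω i) - MvPolynomial.C (a (ω i)))

theorem eval_taylorMvPolynomial {d : ℕ} (k : ℕ) (f : EuclideanSpace ℝ (Fin d) → ℝ)
    (a x : EuclideanSpace ℝ (Fin d)) :
    MvPolynomial.eval x.ofLp (taylorMvPolynomial k f a) =
      ∑ m ∈ Finset.range (k + 1),
        (m.factorial : ℝ)⁻¹ * iteratedFDeriv ℝ m f a (fun _ => x - a) := by
  simp only [taylorMvPolynomial, map_sum, map_mul, MvPolynomial.eval_C, map_prod, map_sub,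
    MvPolynomial.eval_X, iteratedFDeriv_apply_eq_sum_iteratedPartial, PiLp.sub_apply,
    Finset.mul_sum]
  refine Finset.sum_congr rfl fun m _ => Finset.sum_congr rfl fun ω _ => ?_
  ring

theorem totalDegree_taylorMvPolynomial_le {d : ℕ} (k : ℕ) (f : EuclideanSpace ℝ (Fin d) → ℝ)
    (a : EuclideanSpace ℝ (Fin d)) : (taylorMvPolynomial k f a).totalDegree ≤ k := by
  refine MvPolynomial.totalDegree_finsetSum_le fun m hm => ?_
  refine MvPolynomial.totalDegree_finsetSum_le fun ω _ => ?_
  refine (MvPolynomial.totalDegree_mul _ _).trans ?_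
  rw [MvPolynomial.totalDegree_C, zero_add]
  refine (MvPolynomial.totalDegree_finsetProd _ _).trans ?_
  calc _ ≤ ∑ i : Fin m, 1 := Finset.sum_le_sum fun i _ => by
        rw [sub_eq_add_neg, ← map_neg]
        refine (MvPolynomial.totalDegree_add _ _).trans ?_
        simp
    _ ≤ k := by simpa using Nat.lt_succ_iff.1 (Finset.mem_range.1 hm)

/-- Lagrange's remainder is a `k`-th differential at an intermediate point. Against the polynomial
that includes the term of degree `k`, the error is therefore a difference of `k`-th differentials,
where the Hölder condition applies. The factor `d ^ k` counts the multi-indices. -/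
theorem abs_sub_taylorMvPolynomial_le {d k : ℕ} {γ : NNReal}
    {f : EuclideanSpace ℝ (Fin d) → ℝ} (hf : ContDiff ℝ k f)
    (hH : ∀ ω : Fin k → Fin d, HolderWith 1 γ (iteratedPartial f ω))
    (a x : EuclideanSpace ℝ (Fin d)) :
    |f x - MvPolynomial.eval x.ofLp (taylorMvPolynomial k f a)| ≤
      (d : ℝ) ^ k * (‖x - a‖ ^ k * ‖x - a‖ ^ (γ : ℝ)) := by
  obtain ⟨t, ht, h⟩ := exists_taylor_lagrange hf a (x - a)
  rw [add_sub_cancel] at h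
  rw [eval_taylorMvPolynomial, h, Finset.sum_range_succ, add_sub_add_left_eq_sub, ← mul_sub,
    iteratedFDeriv_apply_eq_sum_iteratedPartial, iteratedFDeriv_apply_eq_sum_iteratedPartial,
    ← Finset.sum_sub_distrib, abs_mul]
  have hk : |(k.factorial : ℝ)⁻¹| ≤ 1 := by
    rw [abs_of_nonneg (by positivity)]
    exact inv_le_one_of_one_le₀ (by exact_mod_cast Nat.succ_le_of_lt k.factorial_pos)
  refine (mul_le_of_le_one_left (abs_nonneg _) hk).trans ?_
  refine (Finset.abs_sum_le_sum_abs _ _).trans ?_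
  have key : ∀ ω : Fin k → Fin d, |(∏ i, (x - a) (ω i)) * iteratedPartial f ω (a + t • (x - a)) -
      (∏ i, (x - a) (ω i)) * iteratedPartial f ω a| ≤ ‖x - a‖ ^ k * ‖x - a‖ ^ (γ : ℝ) := by
    intro ω
    rw [← mul_sub, abs_mul, Finset.abs_prod]
    refine mul_le_mul ?_ ?_ (abs_nonneg _) (by positivity)
    · calc _ ≤ ∏ i : Fin k, ‖x - a‖ := Finset.prod_le_prod (fun _ _ => abs_nonneg _)
            fun i _ => PiLp.norm_apply_le (x - a) (ω i)
        _ = _ := by simp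
    · have := (hH ω).dist_le (a + t • (x - a)) a
      rw [Real.dist_eq, dist_eq_norm, add_sub_cancel_left, NNReal.coe_one, one_mul] at this
      refine this.trans (Real.rpow_le_rpow (norm_nonneg _) ?_ γ.2)
      rw [norm_smul, Real.norm_of_nonneg ht.1]
      exact mul_le_of_le_one_left (norm_nonneg _) ht.2
  refine (Finset.sum_le_sum fun ω _ => key ω).trans ?_
  simp

theorem holderOrder_add_holderExponent {s : ℝ} (hs : 0 < s) :
    (holderOrder s : ℝ) + holderExponent s = s := by
  have h1 : (holderOrder s : ℝ) ≤ s := by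
    have : 1 ≤ ⌈s⌉₊ := Nat.one_le_ceil_iff.2 hs
    have h2 := (Nat.ceil_lt_add_one hs.le).le
    rw [holderOrder, Nat.cast_sub this]
    push_cast
    linarith
  rw [holderExponent, Real.coe_toNNReal _ (by linarith)]
  ring

theorem holderWith_of_csNorm_le_one {d : ℕ} {s : ℝ} {f : EuclideanSpace ℝ (Fin d) → ℝ}
    (hf : csNorm s f ≤ 1) (ω : Fin (holderOrder s) → Fin d) :
    HolderWith 1 (holderExponent s) (iteratedPartial f ω) := by
  have h : eHolderNorm (holderExponent s) (iteratedPartial f ω) ≤ 1 := by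
    refine le_trans ?_ hf
    refine le_trans ?_ (le_iSup₂ (holderOrder s) (Finset.self_mem_range_succ _))
    refine le_trans ?_ (le_iSup _ ω)
    rw [if_neg (lt_irrefl _)]
  have hm : MemHolder (holderExponent s) (iteratedPartial f ω) :=
    eHolderNorm_ne_top.1 (ne_top_of_le_ne_top ENNReal.one_ne_top h)
  rw [← hm.coe_nnHolderNorm_eq_eHolderNorm] at h
  exact hm.holderWith.mono (by exact_mod_cast h)

/-- Functions of `C^s` norm at most one are approximated by polynomials at order `s`. -/
theorem exists_mvPolynomial_approx {d : ℕ} {s : ℝ} (hs : 0 < s)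
    {f : EuclideanSpace ℝ (Fin d) → ℝ} (hf : f ∈ csUnitBall d s)
    (a : EuclideanSpace ℝ (Fin d)) :
    ∃ p : MvPolynomial (Fin d) ℝ, p.totalDegree ≤ holderOrder s ∧ ∀ x,
      |f x - MvPolynomial.eval x.ofLp p| ≤ (d : ℝ) ^ holderOrder s * ‖x - a‖ ^ s := by
  refine ⟨_, totalDegree_taylorMvPolynomial_le (holderOrder s) f a, fun x => ?_⟩
  refine (abs_sub_taylorMvPolynomial_le hf.1 (holderWith_of_csNorm_le_one hf.2) a x).trans_eq ?_
  have h0 := holderOrder_add_holderExponent hs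
  rw [← Real.rpow_natCast ‖x - a‖, ← Real.rpow_add_of_nonneg (norm_nonneg _)
    (Nat.cast_nonneg _) (NNReal.coe_nonneg _), h0]

/-- Linear growth of the functions of the unit ball, for `s ≥ 1`. -/
theorem abs_sub_zero_le_of_mem_csUnitBall {d : ℕ} {s : ℝ} (hs : 1 ≤ s)
    {f : EuclideanSpace ℝ (Fin d) → ℝ} (hf : f ∈ csUnitBall d s)
    (x : EuclideanSpace ℝ (Fin d)) : |f x - f 0| ≤ 2 + ‖x‖ := by
  -- Since `s ≥ 1`, order zero forces `s = 1` and exponent 1: `f` is 1-Lipschitz, without any bound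
  -- on `f 0`. For positive order the norm controls `f` uniformly.
  rcases Nat.eq_zero_or_pos (holderOrder s) with h0 | h0
  · have hs1 : (holderExponent s : ℝ) = 1 := by
      have h1 := holderOrder_add_holderExponent (zero_lt_one.trans_le hs)
      have h2 : s ≤ 1 := by
        have : ⌈s⌉₊ ≤ 1 := by unfold holderOrder at h0; omega
        exact (Nat.le_ceil s).trans (by exact_mod_cast this)
      rw [h0] at h1
      push_cast at h1
      linarith
    have h := holderWith_of_csNorm_le_one hf.2 (fun i => (Fin.cast h0 i).elim0)
    have h' := h.dist_le x 0
    rw [hs1] at h'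
    have e : ∀ y, iteratedPartial f (fun i : Fin (holderOrder s) => (Fin.cast h0 i).elim0) y
        = f y := by
      intro y
      unfold iteratedPartial
      generalize holderOrder s = k at h0
      subst h0
      simp
    rw [e, e, Real.dist_eq, dist_zero_right, NNReal.coe_one, one_mul, Real.rpow_one] at h'
    linarith
  · have hb : ∀ y, |f y| ≤ 1 := by
      intro y
      have h : ‖f y‖ₑ ≤ 1 := by
        refine le_trans ?_ hf.2
        refine le_trans ?_ (le_iSup₂ 0 (Finset.mem_range.2 (Nat.succ_pos _)))
        refine le_trans ?_ (le_iSup _ Fin.elim0)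
        rw [if_pos h0]
        refine le_trans ?_ (le_iSup _ y)
        simp [iteratedPartial]
      rw [← Real.norm_eq_abs]
      have := (enorm_le_coe (r := 1)).1 (by simpa using h)
      exact_mod_cast this
    have := norm_nonneg x
    have := hb x
    have := hb 0
    linarith [abs_sub (f x) (f 0)]

/-! ### Bounding the coefficients of a polynomial -/

/-- Values on a grid with `k + 1` points per axis determine a polynomial of degree at most `k`, so
each coefficient is a fixed linear combination of values on a grid inside the unit cube. -/
theorem exists_abs_coeff_le_of_abs_eval_le (d k : ℕ) : ∃ K : ℝ, 0 ≤ K ∧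
    ∀ p : MvPolynomial (Fin d) ℝ, p.totalDegree ≤ k → ∀ M : ℝ,
      (∀ u : Fin d → ℝ, (∀ i, u i ∈ Set.Icc (0 : ℝ) 1) → |MvPolynomial.eval u p| ≤ M) →
      ∀ α ∈ Finset.Iic (Finsupp.equivFunOnFinite.symm fun _ : Fin d => k),
        |MvPolynomial.coeff α p| ≤ K * M := by
  classical
  let V := MvPolynomial.restrictTotalDegree (Fin d) ℝ k
  let pt : (Fin d → Fin (k + 1)) → Fin d → ℝ := fun g i => (g i : ℝ) / (k + 1)
  let L : (Fin d → Fin (k + 1)) → V →ₗ[ℝ] ℝ := fun g =>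
    (MvPolynomial.aeval (pt g)).toLinearMap ∘ₗ V.subtype
  have hL : ∀ g (p : V), L g p = MvPolynomial.eval (pt g) p := fun g p => by
    simp [L, MvPolynomial.aeval_eq_eval]
  have hker : ∀ p : V, (∀ g, L g p = 0) → p = 0 := by
    intro p hp
    have hdeg : (p : MvPolynomial (Fin d) ℝ).totalDegree ≤ k :=
      (MvPolynomial.mem_restrictTotalDegree _ _ _).1 p.2
    refine Subtype.ext (MvPolynomial.eq_zero_of_eval_zero_at_prod_finset _
      (fun _ => Finset.univ.image fun j : Fin (k + 1) => (j : ℝ) / (k + 1)) (fun i => ?_) ?_)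
    · rw [Finset.card_image_of_injective]
      · simpa using Nat.lt_succ_of_le ((MvPolynomial.degreeOf_le_totalDegree _ i).trans hdeg)
      · intro a b h
        have : (k : ℝ) + 1 ≠ 0 := by positivity
        field_simp at h
        exact Fin.ext (by exact_mod_cast h)
    · intro x hx
      simp only [Finset.mem_image, Finset.mem_univ, true_and] at hx
      choose g hg using hx
      have := hp g
      rw [hL] at this
      convert this using 2
      exact congrArg _ (funext fun i => (hg i).symm)
  have hspan : ∀ α : Fin d →₀ ℕ, ∃ c : (Fin d → Fin (k + 1)) → ℝ,
      ∑ g, c g • L g = (MvPolynomial.lcoeff ℝ α) ∘ₗ V.subtype := by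
    intro α
    -- A linear form that vanishes on the common kernel of finitely many others is a combination of
    -- them; by `hker` this kernel is zero.
    refine (Submodule.mem_span_range_iff_exists_fun ℝ).1 (mem_span_of_iInf_ker_le_ker ?_)
    intro p hp
    rw [Submodule.mem_iInf] at hp
    rw [hker p fun g => LinearMap.mem_ker.1 (hp g)]
    exact Submodule.zero_mem _
  choose c hc using hspan
  refine ⟨∑ α ∈ Finset.Iic (Finsupp.equivFunOnFinite.symm fun _ : Fin d => k), ∑ g, |c α g|,
    by positivity, fun p hp M hM α hα => ?_⟩
  have hM0 : 0 ≤ M := (abs_nonneg _).trans (hM 0 (by simp))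
  have h := LinearMap.congr_fun (hc α) ⟨p, (MvPolynomial.mem_restrictTotalDegree _ _ _).2 hp⟩
  simp only [LinearMap.sum_apply, LinearMap.smul_apply, hL, LinearMap.comp_apply,
    Submodule.subtype_apply, MvPolynomial.lcoeff_apply, smul_eq_mul] at h
  rw [← h]
  calc _ ≤ ∑ g, |c α g| * M := by
        refine (Finset.abs_sum_le_sum_abs _ _).trans (Finset.sum_le_sum fun g _ => ?_)
        rw [abs_mul]
        refine mul_le_mul_of_nonneg_left (hM _ fun i => ⟨by positivity, ?_⟩) (abs_nonneg _)
        refine div_le_one_of_le₀ ?_ (by positivity)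
        exact_mod_cast (g i).2.le
    _ ≤ _ := by
        rw [← Finset.sum_mul]
        exact mul_le_mul_of_nonneg_right
          (Finset.single_le_sum (f := fun α => ∑ g, |c α g|) (fun _ _ => by positivity) hα) hM0

/-- The fixed box of exponents replaces the support, so that the test monomials are the same for all
polynomials. -/
theorem eval_eq_sum_Iic {d k : ℕ} {p : MvPolynomial (Fin d) ℝ} (hp : p.totalDegree ≤ k)
    (u : Fin d → ℝ) : MvPolynomial.eval u p =
      ∑ α ∈ Finset.Iic (Finsupp.equivFunOnFinite.symm fun _ : Fin d => k),
        MvPolynomial.coeff α p * ∏ i, u i ^ α i := by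
  rw [MvPolynomial.eval_eq']
  refine Finset.sum_subset (fun α hα => ?_) fun α _ hα => ?_
  · rw [Finset.mem_Iic]
    intro i
    exact ((MvPolynomial.monomial_le_degreeOf i hα).trans
      (MvPolynomial.degreeOf_le_totalDegree p i)).trans hp
  · rw [MvPolynomial.notMem_support_iff.1 hα, zero_mul]

/-- Precomposition of a polynomial with the homothety `u ↦ a + r u`. -/
theorem exists_mvPolynomial_comp_homothety {d : ℕ} (p : MvPolynomial (Fin d) ℝ) (a : Fin d → ℝ)
    (r : ℝ) : ∃ q : MvPolynomial (Fin d) ℝ, q.totalDegree ≤ p.totalDegree ∧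
      ∀ u, MvPolynomial.eval u q = MvPolynomial.eval (fun i => a i + r * u i) p := by
  refine ⟨∑ α ∈ p.support, MvPolynomial.C (p.coeff α) *
    ∏ i, (MvPolynomial.C (a i) + MvPolynomial.C r * MvPolynomial.X i) ^ α i, ?_, fun u => ?_⟩
  · refine MvPolynomial.totalDegree_finsetSum_le fun α hα => ?_
    refine (MvPolynomial.totalDegree_mul _ _).trans ?_
    rw [MvPolynomial.totalDegree_C, zero_add]
    refine (MvPolynomial.totalDegree_finsetProd _ _).trans ?_
    refine le_trans (Finset.sum_le_sum (g := fun i => α i) fun i _ => ?_) ?_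
    · refine (MvPolynomial.totalDegree_pow _ _).trans ?_
      refine (Nat.mul_le_mul_left _ (?_ : _ ≤ 1)).trans_eq (mul_one _)
      refine (MvPolynomial.totalDegree_add _ _).trans ?_
      refine max_le (by simp) ((MvPolynomial.totalDegree_mul _ _).trans (by simp))
    · have := MvPolynomial.le_totalDegree hα
      rwa [Finsupp.sum_fintype _ _ (by simp)] at this
  · rw [MvPolynomial.eval_eq' _ p]
    simp

/-! ### Dyadic decomposition -/

section Dyadic

variable {d : ℕ}

/-- The multi-index of the dyadic cell of side `2⁻ʲ` containing a point. -/
noncomputable def dyadicIndex (j : ℕ) (x : EuclideanSpace ℝ (Fin d)) : Fin d → ℕ :=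
  fun i => ⌊(2 : ℝ) ^ j * x i⌋₊

/-- The indices of the dyadic cells of side `2⁻ʲ` meeting the unit cube. -/
def dyadicIndices (d j : ℕ) : Finset (Fin d → ℕ) :=
  Fintype.piFinset fun _ => Finset.range (2 ^ j + 1)

/-- The part of a dyadic cell inside the unit cube. -/
def dyadicCell (j : ℕ) (z : Fin d → ℕ) : Set (EuclideanSpace ℝ (Fin d)) :=
  {x | x ∈ unitCube d ∧ dyadicIndex j x = z}

/-- The exponents of the monomials of degree at most `k` in each variable. -/
noncomputable def exponents (d k : ℕ) : Finset (Fin d →₀ ℕ) :=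
  Finset.Iic (Finsupp.equivFunOnFinite.symm fun _ : Fin d => k)

/-- A monomial in the coordinates of a dyadic cell rescaled to the unit cube, extended by zero. -/
noncomputable def cellMonomial (j : ℕ) (z : Fin d → ℕ) (α : Fin d →₀ ℕ) :
    EuclideanSpace ℝ (Fin d) → ℝ :=
  (dyadicCell j z).indicator fun x => ∏ i, ((2 : ℝ) ^ j * x i - z i) ^ α i

/-- The index `2 ^ j` does occur, for coordinates equal to 1; hence `2 ^ j + 1` values per axis. -/
theorem dyadicIndex_mem {x : EuclideanSpace ℝ (Fin d)} (hx : x ∈ unitCube d) (j : ℕ) :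
    dyadicIndex j x ∈ dyadicIndices d j := by
  rw [dyadicIndices, Fintype.mem_piFinset]
  intro i
  rw [Finset.mem_range, Nat.lt_succ_iff]
  refine Nat.floor_le_of_le ?_
  push_cast
  exact mul_le_of_le_one_right (by positivity) (hx i).2

/-- Halving the index gives the parent cell, which makes the sum over levels telescope. -/
theorem dyadicIndex_succ_div_two (j : ℕ) (x : EuclideanSpace ℝ (Fin d)) (i : Fin d) :
    dyadicIndex (j + 1) x i / 2 = dyadicIndex j x i := by
  unfold dyadicIndex
  rw [← Nat.floor_div_ofNat]
  congr 1
  ring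

theorem sub_dyadicIndex_mem_Icc {x : EuclideanSpace ℝ (Fin d)} (hx : x ∈ unitCube d) (j : ℕ)
    (i : Fin d) : (2 : ℝ) ^ j * x i - dyadicIndex j x i ∈ Set.Icc (0 : ℝ) 1 := by
  have h0 : 0 ≤ (2 : ℝ) ^ j * x i := mul_nonneg (by positivity) (hx i).1
  have h1 := Nat.floor_le h0
  have h2 := (Nat.lt_floor_add_one ((2 : ℝ) ^ j * x i)).le
  unfold dyadicIndex
  exact ⟨by linarith, by linarith⟩

theorem card_dyadicIndices (d j : ℕ) : (dyadicIndices d j).card = (2 ^ j + 1) ^ d := by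
  simp [dyadicIndices]

theorem norm_le_mul_of_abs_le {v : EuclideanSpace ℝ (Fin d)} {r : ℝ} (h : ∀ i, |v i| ≤ r) :
    ‖v‖ ≤ d * r := by
  have hv : v = ∑ i, v i • EuclideanSpace.single i (1 : ℝ) := by
    ext j
    simp [Finset.sum_apply, Pi.single_apply]
  rw [hv]
  refine (norm_sum_le _ _).trans ((Finset.sum_le_sum (g := fun _ => r) fun i _ => ?_).trans ?_)
  · rw [norm_smul, PiLp.norm_single, norm_one, mul_one]
    exact h i
  · simp

theorem norm_le_of_mem_unitCube {x : EuclideanSpace ℝ (Fin d)} (hx : x ∈ unitCube d) :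
    ‖x‖ ≤ d := by
  simpa using norm_le_mul_of_abs_le (r := 1) fun i => by
    rw [abs_of_nonneg (hx i).1]; exact (hx i).2

theorem abs_cellMonomial_le (j : ℕ) (z : Fin d → ℕ) (α : Fin d →₀ ℕ)
    (x : EuclideanSpace ℝ (Fin d)) :
    |cellMonomial j z α x| ≤ (dyadicCell j z).indicator (fun _ => 1) x := by
  unfold cellMonomial
  by_cases hx : x ∈ dyadicCell j z
  · rw [Set.indicator_of_mem hx, Set.indicator_of_mem hx, Finset.abs_prod]
    refine Finset.prod_le_one (fun _ _ => abs_nonneg _) fun i _ => ?_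
    rw [abs_pow]
    have := sub_dyadicIndex_mem_Icc hx.1 j i
    rw [hx.2] at this
    refine pow_le_one₀ (abs_nonneg _) ?_
    rw [abs_of_nonneg this.1]
    exact this.2
  · rw [Set.indicator_of_notMem hx, Set.indicator_of_notMem hx, abs_zero]

theorem sum_mul_cellMonomial {x : EuclideanSpace ℝ (Fin d)} (hx : x ∈ unitCube d) (j : ℕ)
    (A : Finset (Fin d →₀ ℕ)) (c : (Fin d → ℕ) → (Fin d →₀ ℕ) → ℝ) :
    ∑ z ∈ dyadicIndices d j, ∑ α ∈ A, c z α * cellMonomial j z α x =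
      ∑ α ∈ A, c (dyadicIndex j x) α *
        ∏ i, ((2 : ℝ) ^ j * x i - dyadicIndex j x i) ^ α i := by
  rw [Finset.sum_eq_single_of_mem _ (dyadicIndex_mem hx j)]
  · refine Finset.sum_congr rfl fun α _ => ?_
    rw [cellMonomial, Set.indicator_of_mem (show x ∈ dyadicCell j (dyadicIndex j x) from ⟨hx, rfl⟩)]
  · intro z _ hz
    refine Finset.sum_eq_zero fun α _ => ?_
    rw [cellMonomial, Set.indicator_of_notMem (fun h => hz h.2.symm), mul_zero]

/-- Multiscale decomposition on the unit cube of a function with polynomial approximations of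
order `s` at all points. -/
theorem exists_dyadic_decomposition (d k : ℕ) {s A : ℝ} (hs : 0 ≤ s) (hA : 0 ≤ A) :
    ∃ C : ℝ, 0 ≤ C ∧ ∀ g : EuclideanSpace ℝ (Fin d) → ℝ, (∀ x, |g x| ≤ 2 + ‖x‖) →
      (∀ a, ∃ p : MvPolynomial (Fin d) ℝ, p.totalDegree ≤ k ∧
        ∀ x, |g x - MvPolynomial.eval x.ofLp p| ≤ A * ‖x - a‖ ^ s) →
      ∃ c : ℕ → (Fin d → ℕ) → (Fin d →₀ ℕ) → ℝ,
        (∀ j, ∀ z ∈ dyadicIndices d j, ∀ α ∈ exponents d k, |c j z α| ≤ C * ((1 / 2) ^ j) ^ s) ∧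
        ∀ J, ∀ x ∈ unitCube d,
          |g x - ∑ j ∈ Finset.range (J + 1), ∑ z ∈ dyadicIndices d j, ∑ α ∈ exponents d k,
            c j z α * cellMonomial j z α x| ≤ C * ((1 / 2) ^ J) ^ s := by
  obtain ⟨K, hK0, hK⟩ := exists_abs_coeff_le_of_abs_eval_le d k
  have h2s : (1 : ℝ) ≤ 2 ^ s := Real.one_le_rpow one_le_two hs
  have hds : 0 ≤ (d : ℝ) ^ s := by positivity
  have hAd : 0 ≤ A * (d : ℝ) ^ s := mul_nonneg hA hds
  -- `2 + 2 * d` bounds `g` on the cells of level 0, whose coordinates go up to 2. The last term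
  -- bounds two approximation errors, on the cell and on its parent, whose scale is twice as large:
  -- hence `2 ^ s`.
  set C₁ : ℝ := 2 + 2 * d + 2 * (2 ^ s * (A * d ^ s)) with hC₁
  have hAC : A * (d : ℝ) ^ s ≤ C₁ := by
    have : A * (d : ℝ) ^ s ≤ 2 ^ s * (A * d ^ s) := le_mul_of_one_le_left hAd h2s
    have : (0 : ℝ) ≤ d := Nat.cast_nonneg d
    linarith
  have hC₁0 : 0 ≤ C₁ := hAd.trans hAC
  have hbound : ∀ (j : ℕ) (v : EuclideanSpace ℝ (Fin d)), (∀ i, |v i| ≤ (1 / 2) ^ j) →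
      A * ‖v‖ ^ s ≤ A * (d : ℝ) ^ s * ((1 / 2) ^ j) ^ s := by
    intro j v hv
    rw [mul_assoc, ← Real.mul_rpow (Nat.cast_nonneg d) (by positivity)]
    exact mul_le_mul_of_nonneg_left
      (Real.rpow_le_rpow (norm_nonneg _) (norm_le_mul_of_abs_le hv) hs) hA
  refine ⟨C₁ + K * C₁, by positivity, fun g hg happ => ?_⟩
  choose p hpdeg hp using happ
  let corner : ℕ → (Fin d → ℕ) → EuclideanSpace ℝ (Fin d) := fun j z =>
    WithLp.toLp 2 fun i => (1 / 2 : ℝ) ^ j * z i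
  have hpow : ∀ j : ℕ, (1 / 2 : ℝ) ^ j * 2 ^ j = 1 := fun j => by
    rw [← mul_pow]; norm_num
  -- The increments: the polynomial of a cell minus that of its parent, the full polynomial at level
  -- 0.
  let q : ℕ → (Fin d → ℕ) → MvPolynomial (Fin d) ℝ := fun j z =>
    Nat.casesOn j (p (corner 0 z))
      fun j => p (corner (j + 1) z) - p (corner j fun i => z i / 2)
  have hqdeg : ∀ j z, (q j z).totalDegree ≤ k := by
    intro j z
    cases j with
    | zero => exact hpdeg _
    | succ j => exact (MvPolynomial.totalDegree_sub _ _).trans (max_le (hpdeg _) (hpdeg _))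
  have hq : ∀ j, ∀ z ∈ dyadicIndices d j, ∀ u : Fin d → ℝ, (∀ i, u i ∈ Set.Icc (0 : ℝ) 1) →
      |MvPolynomial.eval (fun i => (1 / 2 : ℝ) ^ j * z i + (1 / 2) ^ j * u i) (q j z)| ≤
        C₁ * ((1 / 2) ^ j) ^ s := by
    intro j z hz u hu
    set x : EuclideanSpace ℝ (Fin d) :=
      WithLp.toLp 2 fun i => (1 / 2 : ℝ) ^ j * z i + (1 / 2) ^ j * u i with hx
    have hxi : ∀ i, x i = (1 / 2 : ℝ) ^ j * z i + (1 / 2) ^ j * u i := fun i => rfl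
    change |MvPolynomial.eval x.ofLp (q j z)| ≤ _
    have hclose : |g x - MvPolynomial.eval x.ofLp (p (corner j z))| ≤
        A * (d : ℝ) ^ s * ((1 / 2) ^ j) ^ s := by
      refine (hp _ x).trans (hbound j _ fun i => ?_)
      have : (x - corner j z) i = (1 / 2) ^ j * u i := by
        rw [PiLp.sub_apply, hxi]
        change _ - (1 / 2 : ℝ) ^ j * z i = _
        ring
      rw [this, abs_of_nonneg (mul_nonneg (by positivity) (hu i).1)]
      exact mul_le_of_le_one_right (by positivity) (hu i).2
    cases j with
    | zero =>
      have hxn : ‖x‖ ≤ d * 2 := norm_le_mul_of_abs_le fun i => by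
        have hzi : z i ≤ 1 := by
          have := Fintype.mem_piFinset.1 hz i
          rw [Finset.mem_range] at this
          omega
        have hzi' : (z i : ℝ) ≤ 1 := by exact_mod_cast hzi
        rw [hxi, pow_zero, one_mul, one_mul, abs_of_nonneg (by have := (hu i).1; positivity)]
        linarith [(hu i).2]
      have h1 := hg x
      have e : MvPolynomial.eval x.ofLp (q 0 z) =
          g x - (g x - MvPolynomial.eval x.ofLp (p (corner 0 z))) := by
        change MvPolynomial.eval x.ofLp (p (corner 0 z)) = _
        ring
      rw [e]
      refine (abs_sub _ _).trans ?_
      rw [pow_zero, Real.one_rpow, mul_one] at hclose ⊢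
      have : A * (d : ℝ) ^ s ≤ 2 ^ s * (A * d ^ s) := le_mul_of_one_le_left hAd h2s
      rw [hC₁]
      linarith
    | succ j =>
      have hfar : |g x - MvPolynomial.eval x.ofLp (p (corner j fun i => z i / 2))| ≤
          A * (d : ℝ) ^ s * ((1 / 2) ^ j) ^ s := by
        refine (hp _ x).trans (hbound j _ fun i => ?_)
        have e : (x - corner j fun i => z i / 2) i =
            (1 / 2) ^ j * (((z i : ℝ) - 2 * (z i / 2 : ℕ) + u i) / 2) := by
          rw [PiLp.sub_apply, hxi]
          change _ - (1 / 2 : ℝ) ^ j * (z i / 2 : ℕ) = _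
          rw [pow_succ]
          ring
        have h1 : (2 * (z i / 2 : ℕ) : ℝ) ≤ z i := by
          exact_mod_cast (by omega : 2 * (z i / 2) ≤ z i)
        have h2 : (z i : ℝ) ≤ 2 * (z i / 2 : ℕ) + 1 := by
          exact_mod_cast (by omega : z i ≤ 2 * (z i / 2) + 1)
        have h3 := (hu i).1
        have h4 := (hu i).2
        rw [e, abs_mul, abs_of_nonneg (by positivity : (0 : ℝ) ≤ (1 / 2) ^ j),
          abs_of_nonneg (by linarith)]
        exact mul_le_of_le_one_right (by positivity) (by linarith)
      have e : MvPolynomial.eval x.ofLp (q (j + 1) z) =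
          (g x - MvPolynomial.eval x.ofLp (p (corner j fun i => z i / 2))) -
          (g x - MvPolynomial.eval x.ofLp (p (corner (j + 1) z))) := by
        change MvPolynomial.eval x.ofLp
          (p (corner (j + 1) z) - p (corner j fun i => z i / 2)) = _
        rw [map_sub]
        ring
      have hw : ((1 / 2 : ℝ) ^ j) ^ s = 2 ^ s * ((1 / 2) ^ (j + 1)) ^ s := by
        rw [← Real.mul_rpow zero_le_two (by positivity), pow_succ]
        congr 1
        ring
      have hw0 : 0 ≤ ((1 / 2 : ℝ) ^ (j + 1)) ^ s := by positivity
      rw [e]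
      refine (abs_sub _ _).trans ?_
      rw [hw] at hfar
      have h5 : A * (d : ℝ) ^ s * ((1 / 2) ^ (j + 1)) ^ s ≤
          2 ^ s * (A * d ^ s) * ((1 / 2) ^ (j + 1)) ^ s :=
        mul_le_mul_of_nonneg_right (le_mul_of_one_le_left hAd h2s) hw0
      have h6 : 0 ≤ (2 + 2 * d : ℝ) * ((1 / 2) ^ (j + 1)) ^ s := by positivity
      rw [hC₁]
      nlinarith
  -- Rescaling each cell to the unit cube lets the same constant `K` bound the coefficients at every
  -- level.
  have hhom := fun j z => exists_mvPolynomial_comp_homothety (q j z)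
    (fun i => (1 / 2 : ℝ) ^ j * z i) ((1 / 2) ^ j)
  choose r hrdeg hr using hhom
  have hrk : ∀ j z, (r j z).totalDegree ≤ k := fun j z => (hrdeg j z).trans (hqdeg j z)
  refine ⟨fun j z α => MvPolynomial.coeff α (r j z), fun j z hz α hα => ?_, fun J x hx => ?_⟩
  · refine (hK (r j z) (hrk j z) (C₁ * ((1 / 2) ^ j) ^ s) (fun u hu => ?_) α hα).trans ?_
    · rw [hr]
      exact hq j z hz u hu
    · rw [← mul_assoc]
      exact mul_le_mul_of_nonneg_right (le_add_of_nonneg_left hC₁0) (by positivity)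
  · have hlevel : ∀ j, ∑ z ∈ dyadicIndices d j, ∑ α ∈ exponents d k,
        MvPolynomial.coeff α (r j z) * cellMonomial j z α x =
        MvPolynomial.eval x.ofLp (q j (dyadicIndex j x)) := by
      intro j
      rw [sum_mul_cellMonomial hx j _ fun z α => MvPolynomial.coeff α (r j z)]
      have h := eval_eq_sum_Iic (hrk j (dyadicIndex j x))
        fun i => (2 : ℝ) ^ j * x i - dyadicIndex j x i
      rw [exponents, ← h, hr]
      congr 2
      funext i
      linear_combination x i * hpow j
    have htel : ∑ j ∈ Finset.range (J + 1), MvPolynomial.eval x.ofLp (q j (dyadicIndex j x)) =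
        MvPolynomial.eval x.ofLp (p (corner J (dyadicIndex J x))) := by
      induction J with
      | zero => simp [q]
      | succ J ih =>
        rw [Finset.sum_range_succ, ih]
        change _ + MvPolynomial.eval x.ofLp (p (corner (J + 1) (dyadicIndex (J + 1) x)) -
          p (corner J fun i => dyadicIndex (J + 1) x i / 2)) = _
        rw [map_sub, funext fun i => dyadicIndex_succ_div_two J x i]
        ring
    simp only [hlevel]
    rw [htel]
    refine ((hp _ x).trans (hbound J _ fun i => ?_)).trans ?_
    · have h := sub_dyadicIndex_mem_Icc hx J i
      have e : (x - corner J (dyadicIndex J x)) i =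
          (1 / 2) ^ J * ((2 : ℝ) ^ J * x i - dyadicIndex J x i) := by
        rw [PiLp.sub_apply]
        change _ - (1 / 2 : ℝ) ^ J * dyadicIndex J x i = _
        linear_combination -x i * hpow J
      rw [e, abs_of_nonneg (mul_nonneg (by positivity) h.1)]
      exact mul_le_of_le_one_right (by positivity) h.2
    · exact mul_le_mul_of_nonneg_right
        (hAC.trans (le_add_of_nonneg_right (by positivity))) (by positivity)

end Dyadic

/-! ### Bounding the dual distance by finitely many test functions -/

theorem measurableSet_unitCube (d : ℕ) : MeasurableSet (unitCube d) := by
  have : unitCube d = ⋂ i, (fun x : EuclideanSpace ℝ (Fin d) => x i) ⁻¹' Set.Icc (0 : ℝ) 1 := by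
    ext x
    simp [unitCube]
  rw [this]
  exact MeasurableSet.iInter fun i => (by fun_prop : Measurable _) measurableSet_Icc

theorem measurableSet_dyadicCell {d : ℕ} (j : ℕ) (z : Fin d → ℕ) :
    MeasurableSet (dyadicCell j z) := by
  have h : Measurable (dyadicIndex j : EuclideanSpace ℝ (Fin d) → Fin d → ℕ) := by
    refine measurable_pi_lambda _ fun i => Nat.measurable_floor.comp ?_
    fun_prop
  exact (measurableSet_unitCube d).inter (h (measurableSet_singleton z))

theorem measurable_cellMonomial {d : ℕ} (j : ℕ) (z : Fin d → ℕ) (α : Fin d →₀ ℕ) :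
    Measurable (cellMonomial j z α) := by
  refine Measurable.indicator ?_ (measurableSet_dyadicCell j z)
  fun_prop

theorem sum_measureReal_dyadicCell_le_one {d : ℕ} (μ : Measure (EuclideanSpace ℝ (Fin d)))
    [IsProbabilityMeasure μ] (j : ℕ) :
    ∑ z ∈ dyadicIndices d j, μ.real (dyadicCell j z) ≤ 1 := by
  rw [← measureReal_biUnion_finset]
  · exact measureReal_le_one
  · intro z _ z' _ hz
    exact Set.disjoint_left.2 fun x h h' => hz (h.2.symm.trans h'.2)
  · exact fun z _ => measurableSet_dyadicCell j z

theorem integrable_cellMonomial {d : ℕ} (ν : Measure (EuclideanSpace ℝ (Fin d)))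
    [IsProbabilityMeasure ν] (j : ℕ) (z : Fin d → ℕ) (α : Fin d →₀ ℕ) :
    Integrable (cellMonomial j z α) ν := by
  refine Integrable.of_bound (measurable_cellMonomial j z α).aestronglyMeasurable 1
    (Filter.Eventually.of_forall fun x => ?_)
  exact (abs_cellMonomial_le j z α x).trans (Set.indicator_le_self' (fun _ _ => zero_le_one) x)

theorem abs_integral_sub_integral_le {E : Type*} [MeasurableSpace E] {ν₀ ν₁ : Measure E}
    [IsProbabilityMeasure ν₀] [IsProbabilityMeasure ν₁] {g h : E → ℝ} {ε : ℝ}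
    (hg₀ : Integrable g ν₀) (hg₁ : Integrable g ν₁) (hh₀ : Integrable h ν₀)
    (hh₁ : Integrable h ν₁) (h₀ : ∀ᵐ x ∂ν₀, |g x - h x| ≤ ε) (h₁ : ∀ᵐ x ∂ν₁, |g x - h x| ≤ ε) :
    |(∫ x, g x ∂ν₀) - ∫ x, g x ∂ν₁| ≤ |(∫ x, h x ∂ν₀) - ∫ x, h x ∂ν₁| + 2 * ε := by
  have key : ∀ (ν : Measure E) [IsProbabilityMeasure ν], Integrable g ν → Integrable h ν →
      (∀ᵐ x ∂ν, |g x - h x| ≤ ε) → |(∫ x, g x ∂ν) - ∫ x, h x ∂ν| ≤ ε := by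
    intro ν _ hg hh hν
    rw [← integral_sub hg hh]
    simpa using norm_integral_le_of_norm_le_const (f := fun x => g x - h x) hν
  have e₀ := abs_le.1 (key ν₀ hg₀ hh₀ h₀)
  have e₁ := abs_le.1 (key ν₁ hg₁ hh₁ h₁)
  have e := abs_le.1 (le_refl |(∫ x, h x ∂ν₀) - ∫ x, h x ∂ν₁|)
  rw [abs_le]
  constructor <;> linarith [e₀.1, e₀.2, e₁.1, e₁.2, e.1, e.2]

theorem integrable_of_mem_csUnitBall {d : ℕ} {s : ℝ} (hs : 1 ≤ s)
    {f : EuclideanSpace ℝ (Fin d) → ℝ} (hf : f ∈ csUnitBall d s)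
    (ν : Measure (EuclideanSpace ℝ (Fin d))) [IsProbabilityMeasure ν]
    (hν : ∀ᵐ x ∂ν, x ∈ unitCube d) : Integrable f ν := by
  refine Integrable.of_bound hf.1.continuous.aestronglyMeasurable (2 + d + |f 0|) ?_
  filter_upwards [hν] with x hx
  have h1 := abs_sub_zero_le_of_mem_csUnitBall hs hf x
  have h2 := norm_le_of_mem_unitCube hx
  have h3 := abs_add_le (f x - f 0) (f 0)
  rw [sub_add_cancel] at h3
  rw [Real.norm_eq_abs]
  linarith

/-- The right-hand side does not involve `f`: the coefficients of the decomposition are replaced by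
their uniform bound, and the truncation error is paid once for each measure. -/
theorem exists_dualDist_le (d : ℕ) {s : ℝ} (hs : 1 ≤ s) : ∃ C : ℝ, 0 ≤ C ∧
    ∀ (ν₀ ν₁ : Measure (EuclideanSpace ℝ (Fin d))) [IsProbabilityMeasure ν₀]
      [IsProbabilityMeasure ν₁], (∀ᵐ x ∂ν₀, x ∈ unitCube d) → (∀ᵐ x ∂ν₁, x ∈ unitCube d) →
      ∀ J : ℕ, dualDist (csUnitBall d s) ν₀ ν₁ ≤ ENNReal.ofReal (C *
        ((∑ j ∈ Finset.range (J + 1), ((1 / 2) ^ j) ^ s * ∑ z ∈ dyadicIndices d j,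
          ∑ α ∈ exponents d (holderOrder s),
            |(∫ x, cellMonomial j z α x ∂ν₀) - ∫ x, cellMonomial j z α x ∂ν₁|) +
        ((1 / 2) ^ J) ^ s)) := by
  have hs0 : 0 < s := zero_lt_one.trans_le hs
  obtain ⟨C, hC0, hC⟩ := exists_dyadic_decomposition d (holderOrder s)
    (A := (d : ℝ) ^ holderOrder s) hs0.le (by positivity)
  refine ⟨2 * C, by positivity, fun ν₀ ν₁ _ _ h₀ h₁ J => ?_⟩
  refine iSup₂_le fun f hf => ENNReal.ofReal_le_ofReal ?_
  -- Two probability measures do not see the constant `f 0`, and only `f - f 0` is bounded when `s =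
  -- 1`.
  obtain ⟨c, hc, happ⟩ := hC (fun x => f x - f 0) (abs_sub_zero_le_of_mem_csUnitBall hs hf)
    fun a => by
      obtain ⟨p, hpd, hp⟩ := exists_mvPolynomial_approx hs0 hf a
      refine ⟨p - MvPolynomial.C (f 0), (MvPolynomial.totalDegree_sub _ _).trans ?_, fun x => ?_⟩
      · simpa using hpd
      · rw [map_sub, MvPolynomial.eval_C, sub_sub_sub_cancel_right]
        exact hp x
  have hf₀ := integrable_of_mem_csUnitBall hs hf ν₀ h₀
  have hf₁ := integrable_of_mem_csUnitBall hs hf ν₁ h₁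
  set h : EuclideanSpace ℝ (Fin d) → ℝ := fun x => ∑ j ∈ Finset.range (J + 1),
    ∑ z ∈ dyadicIndices d j, ∑ α ∈ exponents d (holderOrder s),
      c j z α * cellMonomial j z α x with hh
  have hint : ∀ (ν : Measure (EuclideanSpace ℝ (Fin d))) [IsProbabilityMeasure ν],
      Integrable h ν ∧ ∫ x, h x ∂ν = ∑ j ∈ Finset.range (J + 1),
        ∑ z ∈ dyadicIndices d j, ∑ α ∈ exponents d (holderOrder s),
          c j z α * ∫ x, cellMonomial j z α x ∂ν := by
    intro ν _
    have i0 : ∀ j z α, Integrable (fun x => c j z α * cellMonomial j z α x) ν := fun j z α =>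
      (integrable_cellMonomial ν j z α).const_mul _
    have i1 : ∀ j z, Integrable (fun x => ∑ α ∈ exponents d (holderOrder s),
        c j z α * cellMonomial j z α x) ν := fun j z =>
      integrable_finsetSum _ fun α _ => i0 j z α
    have i2 : ∀ j, Integrable (fun x => ∑ z ∈ dyadicIndices d j,
        ∑ α ∈ exponents d (holderOrder s), c j z α * cellMonomial j z α x) ν := fun j =>
      integrable_finsetSum _ fun z _ => i1 j z
    refine ⟨integrable_finsetSum _ fun j _ => i2 j, ?_⟩
    rw [integral_finsetSum _ fun j _ => i2 j]
    refine Finset.sum_congr rfl fun j _ => ?_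
    rw [integral_finsetSum _ fun z _ => i1 j z]
    refine Finset.sum_congr rfl fun z _ => ?_
    rw [integral_finsetSum _ fun α _ => i0 j z α]
    exact Finset.sum_congr rfl fun α _ => integral_const_mul _ _
  have hmain := abs_integral_sub_integral_le (hf₀.sub (integrable_const (f 0)))
    (hf₁.sub (integrable_const (f 0))) (hint ν₀).1 (hint ν₁).1 (h₀.mono fun x hx => happ J x hx)
    (h₁.mono fun x hx => happ J x hx)
  simp only [Pi.sub_apply] at hmain
  rw [integral_sub hf₀ (integrable_const _), integral_sub hf₁ (integrable_const _)] at hmain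
  simp only [integral_const, probReal_univ, one_smul, sub_sub_sub_cancel_right] at hmain
  refine hmain.trans ?_
  have hsum : |(∫ x, h x ∂ν₀) - ∫ x, h x ∂ν₁| ≤ C * ∑ j ∈ Finset.range (J + 1),
      ((1 / 2) ^ j) ^ s * ∑ z ∈ dyadicIndices d j, ∑ α ∈ exponents d (holderOrder s),
        |(∫ x, cellMonomial j z α x ∂ν₀) - ∫ x, cellMonomial j z α x ∂ν₁| := by
    rw [(hint ν₀).2, (hint ν₁).2]
    simp only [← Finset.sum_sub_distrib, ← mul_sub, Finset.mul_sum]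
    refine (Finset.abs_sum_le_sum_abs _ _).trans (Finset.sum_le_sum fun j _ => ?_)
    refine (Finset.abs_sum_le_sum_abs _ _).trans (Finset.sum_le_sum fun z hz => ?_)
    refine (Finset.abs_sum_le_sum_abs _ _).trans (Finset.sum_le_sum fun α hα => ?_)
    rw [abs_mul, ← mul_assoc]
    exact mul_le_mul_of_nonneg_right (hc j z hz α hα) (abs_nonneg _)
  have hpos : 0 ≤ ∑ j ∈ Finset.range (J + 1),
      ((1 / 2 : ℝ) ^ j) ^ s * ∑ z ∈ dyadicIndices d j, ∑ α ∈ exponents d (holderOrder s),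
        |(∫ x, cellMonomial j z α x ∂ν₀) - ∫ x, cellMonomial j z α x ∂ν₁| :=
    Finset.sum_nonneg fun j _ => mul_nonneg (by positivity)
      (Finset.sum_nonneg fun z _ => Finset.sum_nonneg fun α _ => abs_nonneg _)
  nlinarith [mul_nonneg hC0 hpos]

/-! ### Empirical measures -/

theorem integral_empiricalMeasure {E : Type*} [MeasurableSpace E] [MeasurableSingletonClass E]
    (x : ℕ → E) (n : ℕ) (f : E → ℝ) :
    ∫ y, f y ∂empiricalMeasure x n = (n : ℝ)⁻¹ * ∑ k ∈ Finset.Icc 1 n, f (x k) := by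
  rw [empiricalMeasure, integral_smul_measure, integral_finsetSum_measure
    fun k _ => integrable_dirac (by simp)]
  simp [integral_dirac]

theorem isProbabilityMeasure_empiricalMeasure {E : Type*} [MeasurableSpace E] (x : ℕ → E) {n : ℕ}
    (hn : n ≠ 0) : IsProbabilityMeasure (empiricalMeasure x n) := by
  constructor
  rw [empiricalMeasure, Measure.smul_apply, Measure.finsetSum_apply]
  simp [ENNReal.inv_mul_cancel (Nat.cast_ne_zero.2 hn) (ENNReal.natCast_ne_top n)]

theorem ae_mem_empiricalMeasure {E : Type*} [MeasurableSpace E] {x : ℕ → E} {n : ℕ} {S : Set E}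
    (hS : MeasurableSet S) (hx : ∀ k, x k ∈ S) : ∀ᵐ y ∂empiricalMeasure x n, y ∈ S := by
  rw [ae_iff, empiricalMeasure, Measure.smul_apply, Measure.finsetSum_apply]
  have : ∀ k ∈ Finset.Icc 1 n, Measure.dirac (x k) {a | a ∉ S} = 0 := fun k _ => by
    change Measure.dirac (x k) Sᶜ = 0
    rw [Measure.dirac_apply' _ hS.compl]
    simp [hx k]
  rw [Finset.sum_congr rfl this]
  simp

section Probability

variable {Ω : Type*} [MeasurableSpace Ω] {P : Measure Ω} [IsProbabilityMeasure P]

/-- This is the nonnegativity of the variance of `|Z|`. -/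
theorem integral_abs_le_sqrt_integral_sq {Z : Ω → ℝ} (hZ : MemLp Z 2 P) :
    ∫ ω, |Z ω| ∂P ≤ Real.sqrt (∫ ω, Z ω ^ 2 ∂P) := by
  have h := variance_eq_sub hZ.abs
  have h0 := variance_nonneg |Z| P
  have e : ∫ ω, (|Z| ^ 2) ω ∂P = ∫ ω, Z ω ^ 2 ∂P := by
    simp
  rw [e] at h
  refine Real.le_sqrt_of_sq_le ?_
  have : ∫ ω, |Z| ω ∂P = ∫ ω, |Z ω| ∂P := rfl
  rw [this] at h
  linarith

/-- By independence the variance of the empirical mean is at most `∫ φ² dμ / n`, and `φ² ≤ |φ| ≤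
1_S`. Keeping `μ(S)` here, rather than 1, is what allows summation over cells. -/
theorem integral_abs_integral_empiricalMeasure_sub_le {E : Type*} [MeasurableSpace E]
    [MeasurableSingletonClass E] {μ : Measure E} [IsProbabilityMeasure μ] {X : ℕ → Ω → E}
    (hX : ∀ k, Measurable (X k)) (hind : iIndepFun X P) (hlaw : ∀ k, P.map (X k) = μ)
    {φ : E → ℝ} (hφ : Measurable φ) {S : Set E} (hS : MeasurableSet S)
    (hφS : ∀ x, |φ x| ≤ S.indicator (fun _ => 1) x) {n : ℕ} (hn : n ≠ 0) :
    Integrable (fun ω => |(∫ x, φ x ∂empiricalMeasure (fun k => X k ω) n) - ∫ x, φ x ∂μ|) P ∧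
    ∫ ω, |(∫ x, φ x ∂empiricalMeasure (fun k => X k ω) n) - ∫ x, φ x ∂μ| ∂P ≤
      Real.sqrt (μ.real S) / Real.sqrt n := by
  have hφ1 : ∀ x, ‖φ x‖ ≤ 1 := fun x =>
    (hφS x).trans (Set.indicator_le_self' (fun _ _ => zero_le_one) x)
  have hL : ∀ k, MemLp (φ ∘ X k) 2 P := fun k =>
    MemLp.of_bound (hφ.comp (hX k)).aestronglyMeasurable 1
      (Filter.Eventually.of_forall fun ω => hφ1 _)
  have hmean : ∀ k, ∫ ω, (φ ∘ X k) ω ∂P = ∫ x, φ x ∂μ := fun k => by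
    rw [← hlaw k, integral_map (hX k).aemeasurable hφ.aestronglyMeasurable]
    rfl
  set Y : Ω → ℝ := ∑ k ∈ Finset.Icc 1 n, φ ∘ X k with hY
  have hYL : MemLp Y 2 P := memLp_finsetSum' _ fun k _ => hL k
  have hYmean : ∫ ω, Y ω ∂P = n * ∫ x, φ x ∂μ := by
    simp only [hY, Finset.sum_apply]
    rw [integral_finsetSum _ fun k _ => (hL k).integrable one_le_two,
      Finset.sum_congr rfl fun k _ => hmean k]
    simp
  have hvar : Var[Y; P] ≤ n * μ.real S := by
    rw [hY, IndepFun.variance_sum (fun k _ => hL k)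
      fun i _ j _ hij => (hind.indepFun hij).comp hφ hφ]
    calc _ ≤ ∑ k ∈ Finset.Icc 1 n, μ.real S := Finset.sum_le_sum fun k _ => by
          refine (variance_le_expectation_sq (hL k).1).trans ?_
          have e : ∫ ω, ((φ ∘ X k) ^ 2) ω ∂P = ∫ x, φ x ^ 2 ∂μ := by
            rw [← hlaw k, integral_map (hX k).aemeasurable (hφ.pow_const 2).aestronglyMeasurable]
            rfl
          rw [e, ← integral_indicator_one hS]
          refine integral_mono ?_ ?_ fun x => ?_
          · refine Integrable.of_bound (hφ.pow_const 2).aestronglyMeasurable 1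
              (Filter.Eventually.of_forall fun x => ?_)
            rw [norm_pow]
            exact pow_le_one₀ (norm_nonneg _) (hφ1 x)
          · exact (integrable_const 1).indicator hS
          · change φ x ^ 2 ≤ S.indicator (fun _ => 1) x
            refine le_trans ?_ (hφS x)
            rw [← sq_abs, sq]
            exact mul_le_of_le_one_left (abs_nonneg _) (hφ1 x)
      _ = _ := by simp
  have hn0 : (0 : ℝ) < n := by exact_mod_cast Nat.pos_of_ne_zero hn
  have hrepr : ∀ ω, |(∫ x, φ x ∂empiricalMeasure (fun k => X k ω) n) - ∫ x, φ x ∂μ| =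
      (n : ℝ)⁻¹ * |Y ω - ∫ ω, Y ω ∂P| := by
    intro ω
    rw [integral_empiricalMeasure, hYmean, ← abs_of_pos (inv_pos.2 hn0), ← abs_mul,
      abs_of_pos (inv_pos.2 hn0), mul_sub, inv_mul_cancel_left₀ hn0.ne']
    simp [hY]
  have hZL : MemLp (fun ω => Y ω - ∫ ω, Y ω ∂P) 2 P := hYL.sub (memLp_const _)
  simp only [hrepr]
  refine ⟨((hZL.integrable one_le_two).abs).const_mul _, ?_⟩
  rw [integral_const_mul]
  have h1 := integral_abs_le_sqrt_integral_sq hZL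
  rw [← variance_eq_integral hYL.aemeasurable] at h1
  have h2 := h1.trans (Real.sqrt_le_sqrt hvar)
  rw [Real.sqrt_mul hn0.le] at h2
  have hsq : 0 < Real.sqrt n := Real.sqrt_pos.2 hn0
  calc _ ≤ (n : ℝ)⁻¹ * (Real.sqrt n * Real.sqrt (μ.real S)) :=
        mul_le_mul_of_nonneg_left h2 (by positivity)
    _ = _ := by
        have : (n : ℝ)⁻¹ = (Real.sqrt n)⁻¹ * (Real.sqrt n)⁻¹ := by
          rw [← mul_inv, Real.mul_self_sqrt hn0.le]
        rw [this]
        field_simp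

end Probability

/-- The dual distance of the empirical measure is measurable, as a lower semicontinuous function of
the sample. -/
theorem measurable_dualDist_empiricalMeasure {E Ω : Type*} [TopologicalSpace E]
    [SecondCountableTopology E] [MeasurableSpace E] [BorelSpace E] [MeasurableSingletonClass E]
    [MeasurableSpace Ω] {F : Set (E → ℝ)} (hF : ∀ f ∈ F, Continuous f) (μ : Measure E)
    {X : ℕ → Ω → E} (hX : ∀ k, Measurable (X k)) (n : ℕ) :
    Measurable fun ω => dualDist F (empiricalMeasure (fun k => X k ω) n) μ := by
  have h : LowerSemicontinuous fun x : ℕ → E => dualDist F (empiricalMeasure x n) μ := by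
    -- Each `f` gives a continuous function of the sample, and lower semicontinuity survives
    -- uncountable suprema.
    refine lowerSemicontinuous_biSup fun f hf =>
      (ENNReal.continuous_ofReal.comp ?_).lowerSemicontinuous
    simp only [integral_empiricalMeasure]
    have := hF f hf
    fun_prop
  exact h.measurable.comp (measurable_pi_lambda _ hX)

/-- Cauchy–Schwarz, the cells being disjoint with total mass at most 1. Here the dependence on `μ`
is lost. -/
theorem sum_sqrt_measureReal_dyadicCell_le {d : ℕ} (μ : Measure (EuclideanSpace ℝ (Fin d)))
    [IsProbabilityMeasure μ] (j : ℕ) :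
    ∑ z ∈ dyadicIndices d j, Real.sqrt (μ.real (dyadicCell j z)) ≤
      Real.sqrt ((2 ^ j + 1) ^ d) := by
  refine Real.le_sqrt_of_sq_le (sq_sum_le_card_mul_sum_sq.trans ?_)
  rw [card_dyadicIndices]
  simp only [Real.sq_sqrt measureReal_nonneg]
  push_cast
  exact mul_le_of_le_one_right (by positivity) (sum_measureReal_dyadicCell_le_one μ j)

theorem exists_lintegral_dualDist_le (d : ℕ) {s : ℝ} (hs : 1 ≤ s) : ∃ C : ℝ, 0 ≤ C ∧
    ∀ (μ : Measure (EuclideanSpace ℝ (Fin d))) [IsProbabilityMeasure μ], μ (unitCube d) = 1 →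
    ∀ {Ω : Type*} [MeasurableSpace Ω] (P : Measure Ω) [IsProbabilityMeasure P]
      (X : ℕ → Ω → EuclideanSpace ℝ (Fin d)),
      (∀ k, Measurable (X k)) → iIndepFun X P → (∀ k, P.map (X k) = μ) →
    ∀ n : ℕ, n ≠ 0 → ∀ J : ℕ,
      ∫⁻ ω, dualDist (csUnitBall d s) (empiricalMeasure (fun k => X k ω) n) μ ∂P ≤
        ENNReal.ofReal (C * ((∑ j ∈ Finset.range (J + 1), ((1 / 2) ^ j) ^ s *
          (Real.sqrt ((2 ^ j + 1) ^ d) / Real.sqrt n)) + ((1 / 2) ^ J) ^ s)) := by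
  obtain ⟨C, hC0, hC⟩ := exists_dualDist_le d hs
  set A := exponents d (holderOrder s) with hA
  -- Each cell carries `A.card` monomials; the `+ 1` covers the truncation term.
  refine ⟨C * (A.card + 1), by positivity,
    fun μ _ hμ Ω _ P _ X hX hind hlaw n hn J => ?_⟩
  have hμae : ∀ᵐ x ∂μ, x ∈ unitCube d := by
    rw [ae_iff]
    exact (prob_compl_eq_zero_iff (measurableSet_unitCube d)).2 hμ
  have hXae : ∀ᵐ ω ∂P, ∀ k, X k ω ∈ unitCube d := ae_all_iff.2 fun k =>
    ae_of_ae_map (hX k).aemeasurable (by rw [hlaw k]; exact hμae)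
  set D : ℕ → (Fin d → ℕ) → (Fin d →₀ ℕ) → Ω → ℝ := fun j z α ω =>
    |(∫ x, cellMonomial j z α x ∂empiricalMeasure (fun k => X k ω) n) -
      ∫ x, cellMonomial j z α x ∂μ| with hD
  have hDint : ∀ j z α, Integrable (D j z α) P ∧
      ∫ ω, D j z α ω ∂P ≤ Real.sqrt (μ.real (dyadicCell j z)) / Real.sqrt n := fun j z α =>
    integral_abs_integral_empiricalMeasure_sub_le hX hind hlaw (measurable_cellMonomial j z α)
      (measurableSet_dyadicCell j z) (abs_cellMonomial_le j z α) hn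
  have i1 : ∀ j z, Integrable (fun ω => ∑ α ∈ A, D j z α ω) P := fun j z =>
    integrable_finsetSum _ fun α _ => (hDint j z α).1
  have i2 : ∀ j, Integrable (fun ω => ((1 / 2 : ℝ) ^ j) ^ s *
      ∑ z ∈ dyadicIndices d j, ∑ α ∈ A, D j z α ω) P := fun j =>
    (integrable_finsetSum _ fun z _ => i1 j z).const_mul _
  have i3 : Integrable (fun ω => ∑ j ∈ Finset.range (J + 1), ((1 / 2 : ℝ) ^ j) ^ s *
      ∑ z ∈ dyadicIndices d j, ∑ α ∈ A, D j z α ω) P :=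
    integrable_finsetSum _ fun j _ => i2 j
  have i4 : Integrable (fun ω => C * ((∑ j ∈ Finset.range (J + 1), ((1 / 2 : ℝ) ^ j) ^ s *
      ∑ z ∈ dyadicIndices d j, ∑ α ∈ A, D j z α ω) + ((1 / 2) ^ J) ^ s)) P :=
    (i3.add (integrable_const _)).const_mul _
  have hDnn : ∀ j z α ω, 0 ≤ D j z α ω := fun _ _ _ _ => abs_nonneg _
  calc _ ≤ ∫⁻ ω, ENNReal.ofReal (C * ((∑ j ∈ Finset.range (J + 1), ((1 / 2 : ℝ) ^ j) ^ s *
      ∑ z ∈ dyadicIndices d j, ∑ α ∈ A, D j z α ω) + ((1 / 2) ^ J) ^ s)) ∂P := by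
        refine lintegral_mono_ae ?_
        filter_upwards [hXae] with ω hω
        have := isProbabilityMeasure_empiricalMeasure (fun k => X k ω) hn
        exact hC _ μ (ae_mem_empiricalMeasure (measurableSet_unitCube d) hω) hμae J
    _ = ENNReal.ofReal (∫ ω, C * ((∑ j ∈ Finset.range (J + 1), ((1 / 2 : ℝ) ^ j) ^ s *
      ∑ z ∈ dyadicIndices d j, ∑ α ∈ A, D j z α ω) + ((1 / 2) ^ J) ^ s) ∂P) := by
        refine (ofReal_integral_eq_lintegral_ofReal i4 (Filter.Eventually.of_forall fun ω => ?_)).symm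
        refine mul_nonneg hC0 (add_nonneg (Finset.sum_nonneg fun j _ => mul_nonneg (by positivity)
          (Finset.sum_nonneg fun z _ => Finset.sum_nonneg fun α _ => hDnn j z α ω))
          (by positivity))
    _ ≤ _ := by
        refine ENNReal.ofReal_le_ofReal ?_
        rw [integral_const_mul, integral_add i3 (integrable_const _), mul_assoc]
        refine mul_le_mul_of_nonneg_left ?_ hC0
        rw [integral_finsetSum _ fun j _ => i2 j, add_mul, one_mul]
        simp only [integral_const, probReal_univ, one_smul]
        have hw : 0 ≤ ((1 / 2 : ℝ) ^ J) ^ s := by positivity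
        have hS : 0 ≤ ∑ j ∈ Finset.range (J + 1), ((1 / 2 : ℝ) ^ j) ^ s *
          (Real.sqrt ((2 ^ j + 1) ^ d) / Real.sqrt n) :=
          Finset.sum_nonneg fun j _ => by positivity
        have hmain : ∑ j ∈ Finset.range (J + 1), ∫ ω, ((1 / 2 : ℝ) ^ j) ^ s *
            ∑ z ∈ dyadicIndices d j, ∑ α ∈ A, D j z α ω ∂P ≤
            A.card * ∑ j ∈ Finset.range (J + 1), ((1 / 2 : ℝ) ^ j) ^ s *
          (Real.sqrt ((2 ^ j + 1) ^ d) / Real.sqrt n) := by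
          rw [Finset.mul_sum]
          refine Finset.sum_le_sum fun j _ => ?_
          rw [integral_const_mul, integral_finsetSum _ fun z _ => i1 j z, mul_left_comm]
          refine mul_le_mul_of_nonneg_left ?_ (by positivity)
          calc _ ≤ ∑ z ∈ dyadicIndices d j,
                A.card * (Real.sqrt (μ.real (dyadicCell j z)) / Real.sqrt n) :=
                Finset.sum_le_sum fun z _ => by
                  rw [integral_finsetSum _ fun α _ => (hDint j z α).1, ← nsmul_eq_mul]
                  exact Finset.sum_le_card_nsmul _ _ _ fun α _ => (hDint j z α).2
            _ ≤ _ := by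
                rw [← Finset.mul_sum, ← Finset.sum_div]
                gcongr
                exact sum_sqrt_measureReal_dyadicCell_le μ j
        have hcard : (0 : ℝ) ≤ A.card := Nat.cast_nonneg _
        rw [mul_add]
        have := mul_nonneg hcard hw
        linarith

/-! ### Optimizing the number of scales -/

/-- Since `2 ^ j + 1 ≤ 2 ^ (j + 1)`, the contribution of level `j` is geometric of ratio `2 ^ (d / 2
- s)`, whose position relative to 1 separates the three regimes. -/
theorem half_pow_rpow_mul_sqrt_le (d : ℕ) (s : ℝ) (j : ℕ) :
    ((1 / 2 : ℝ) ^ j) ^ s * Real.sqrt ((2 ^ j + 1) ^ d) ≤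
      2 ^ ((d : ℝ) / 2) * ((2 : ℝ) ^ ((d : ℝ) / 2 - s)) ^ j := by
  have h1 : Real.sqrt ((2 ^ j + 1) ^ d) ≤ (2 : ℝ) ^ ((d : ℝ) / 2) * (2 ^ ((d : ℝ) / 2)) ^ j := by
    refine Real.sqrt_le_iff.2 ⟨by positivity, ?_⟩
    have e : ((2 : ℝ) ^ ((d : ℝ) / 2) * (2 ^ ((d : ℝ) / 2)) ^ j) ^ 2 = (2 ^ (j + 1)) ^ d := by
      rw [← pow_succ', ← pow_mul, mul_comm, pow_mul, ← Real.rpow_natCast (2 ^ ((d : ℝ) / 2)) 2,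
        ← Real.rpow_mul zero_le_two, Nat.cast_ofNat, div_mul_cancel₀ _ two_ne_zero,
        Real.rpow_natCast, ← pow_mul, mul_comm, pow_mul]
    rw [e]
    refine pow_le_pow_left₀ (by positivity) ?_ d
    have : (1 : ℝ) ≤ 2 ^ j := one_le_pow₀ one_le_two
    rw [pow_succ]
    linarith
  have h2 : ((1 / 2 : ℝ) ^ j) ^ s = ((2 : ℝ) ^ (-s)) ^ j := by
    rw [← Real.rpow_natCast, ← Real.rpow_natCast, ← Real.rpow_mul (by norm_num),
      ← Real.rpow_mul zero_le_two, one_div, Real.inv_rpow zero_le_two, ← Real.rpow_neg zero_le_two]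
    congr 1
    ring
  rw [h2]
  refine (mul_le_mul_of_nonneg_left h1 (by positivity)).trans_eq ?_
  rw [mul_left_comm, ← mul_pow, ← Real.rpow_add zero_lt_two]
  congr 3
  ring

/-- For this level `J`, `n < 2 ^ (d * (J + 1))`, so `2 ^ (-J)` is less than `2 * n ^ (-1 / d)`. -/
theorem half_pow_log_rpow_le {d : ℕ} (hd : d ≠ 0) {s : ℝ} (hs : 0 ≤ s) {n : ℕ} (hn : n ≠ 0) :
    ((1 / 2 : ℝ) ^ Nat.log (2 ^ d) n) ^ s ≤ 2 ^ s * (1 / (n : ℝ) ^ (s / d)) := by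
  have hn0 : (0 : ℝ) < n := by exact_mod_cast Nat.pos_of_ne_zero hn
  have hd0 : (d : ℝ) ≠ 0 := Nat.cast_ne_zero.2 hd
  have h := Nat.lt_pow_succ_log_self (Nat.one_lt_two_pow hd) n
  set J := Nat.log (2 ^ d) n
  have h' : (n : ℝ) ≤ (2 ^ (J + 1)) ^ (d : ℝ) := by
    rw [Real.rpow_natCast, ← pow_mul, mul_comm, pow_mul]
    exact_mod_cast h.le
  have h2 : (n : ℝ) ^ (s / d) ≤ (2 ^ (J + 1)) ^ s := by
    refine (Real.rpow_le_rpow hn0.le h' (by positivity)).trans_eq ?_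
    rw [← Real.rpow_mul (by positivity), mul_div_cancel₀ _ hd0]
  rw [mul_one_div, le_div_iff₀ (by positivity)]
  refine (mul_le_mul_of_nonneg_left h2 (by positivity)).trans_eq ?_
  rw [← Real.mul_rpow (by positivity) (by positivity), pow_succ, ← mul_assoc, ← mul_pow]
  norm_num

theorem exists_scale_sum_le_rate (d : ℕ) {s : ℝ} (hs : 1 ≤ s) : ∃ C : ℝ, 0 < C ∧
    ∀ n : ℕ, 2 ≤ n → ∃ J : ℕ,
      (∑ j ∈ Finset.range (J + 1), ((1 / 2 : ℝ) ^ j) ^ s *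
        (Real.sqrt ((2 ^ j + 1) ^ d) / Real.sqrt n)) + ((1 / 2) ^ J) ^ s ≤ C * rate d s n := by
  set r : ℝ := (2 : ℝ) ^ ((d : ℝ) / 2 - s) with hr
  set b : ℝ := (2 : ℝ) ^ ((d : ℝ) / 2) with hb
  have hb0 : 0 < b := by positivity
  have hr0 : 0 < r := by positivity
  have hs0 : 0 < s := zero_lt_one.trans_le hs
  have hsum : ∀ n J : ℕ, ∑ j ∈ Finset.range (J + 1), ((1 / 2 : ℝ) ^ j) ^ s *
      (Real.sqrt ((2 ^ j + 1) ^ d) / Real.sqrt n) ≤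
        b * ((∑ j ∈ Finset.range (J + 1), r ^ j) / Real.sqrt n) := by
    intro n J
    rw [Finset.sum_div, Finset.mul_sum]
    refine Finset.sum_le_sum fun j _ => ?_
    rw [← mul_div_assoc, ← mul_div_assoc]
    exact div_le_div_of_nonneg_right (half_pow_rpow_mul_sqrt_le d s j) (Real.sqrt_nonneg _)
  have hpow : ∀ n J : ℕ, (b * ((∑ j ∈ Finset.range (J + 1), r ^ j) / Real.sqrt n)) =
      b * (∑ j ∈ Finset.range (J + 1), r ^ j) * (1 / Real.sqrt n) := fun n J => by ring
  rcases lt_trichotomy ((d : ℝ) / 2) s with hlt | heq | hgt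
  · have hr1 : r < 1 := Real.rpow_lt_one_of_one_lt_of_neg one_lt_two (by linarith)
    -- The series converges, so any large `J` will do; `J = n` makes the truncation error at most `2
    -- ^ (-n)`.
    refine ⟨b * (1 - r)⁻¹ + 1, by have := sub_pos.2 hr1; positivity, fun n hn => ⟨n, ?_⟩⟩
    rw [rate, if_pos hlt, add_mul, one_mul]
    have hn1 : (1 : ℝ) ≤ n := by exact_mod_cast (by omega : 1 ≤ n)
    refine add_le_add ((hsum n n).trans ?_) ?_
    · rw [hpow]
      refine mul_le_mul_of_nonneg_right (mul_le_mul_of_nonneg_left ?_ hb0.le) (by positivity)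
      rw [← tsum_geometric_of_lt_one hr0.le hr1]
      exact (summable_geometric_of_lt_one hr0.le hr1).sum_le_tsum _ fun _ _ => by positivity
    · have h1 : ((1 / 2 : ℝ) ^ n) ^ s ≤ (1 / 2) ^ n := by
        conv_rhs => rw [← Real.rpow_one ((1 / 2 : ℝ) ^ n)]
        exact Real.rpow_le_rpow_of_exponent_ge (by positivity)
          (pow_le_one₀ (by norm_num) (by norm_num)) hs
      refine h1.trans ?_
      rw [one_div_pow]
      have h2 : (n : ℝ) ≤ 2 ^ n := by exact_mod_cast Nat.lt_two_pow_self.le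
      have h3 : Real.sqrt n ≤ n := Real.sqrt_le_iff.2 ⟨by linarith, by nlinarith⟩
      exact one_div_le_one_div_of_le (Real.sqrt_pos.2 (by linarith)) (h3.trans h2)
  · have hd : d ≠ 0 := by
      rintro rfl
      simp at heq
      linarith
    have hr1 : r = 1 := by rw [hr, heq, sub_self, Real.rpow_zero]
    have hl2 : 0 < Real.log 2 := Real.log_pos one_lt_two
    -- As `2 ^ J ≤ n` and `log 2 ≤ log n`, the number `J + 1` of levels is at most `2 * log n / log
    -- 2`. The second term absorbs the truncation error, which lacks the logarithm.
    refine ⟨b * (2 / Real.log 2) + 2 ^ s / Real.log 2, by positivity,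
      fun n hn => ⟨Nat.log (2 ^ d) n, ?_⟩⟩
    have hn2 : (2 : ℝ) ≤ n := by exact_mod_cast hn
    have hlog : Real.log 2 ≤ Real.log n := Real.log_le_log zero_lt_two hn2
    rw [rate, if_neg (by linarith), if_pos heq.symm, add_mul]
    refine add_le_add ((hsum n _).trans ?_) ((half_pow_log_rpow_le hd hs0.le (by omega)).trans ?_)
    · simp only [hr1, one_pow, Finset.sum_const, Finset.card_range, nsmul_eq_mul, mul_one]
      rw [mul_assoc]
      refine mul_le_mul_of_nonneg_left ?_ hb0.le
      rw [← mul_div_assoc]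
      refine div_le_div_of_nonneg_right ?_ (Real.sqrt_nonneg _)
      have h1 : (2 : ℝ) ^ Nat.log (2 ^ d) n ≤ n := by
        have h2 := Nat.pow_log_le_self (2 ^ d) (by omega : n ≠ 0)
        refine le_trans (pow_le_pow_left₀ zero_le_two ?_ _) (by exact_mod_cast h2 :
          ((2 : ℝ) ^ d) ^ Nat.log (2 ^ d) n ≤ n)
        exact le_self_pow₀ one_le_two hd
      have h3 := Real.log_le_log (by positivity) h1
      rw [Real.log_pow] at h3
      rw [div_mul_eq_mul_div, le_div_iff₀ hl2]
      push_cast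
      linarith
    · have e : s / d = 1 / 2 := by
        rw [← heq]
        field_simp
      rw [e, ← Real.sqrt_eq_rpow, div_mul_div_comm, mul_one_div, mul_comm (Real.log 2),
        mul_div_mul_comm]
      exact le_mul_of_one_le_right (by positivity) ((one_le_div hl2).2 hlog)
  · have hd : d ≠ 0 := by
      rintro rfl
      simp at hgt
      linarith
    have hd0 : (0 : ℝ) < d := by exact_mod_cast Nat.pos_of_ne_zero hd
    have hr1 : 1 < r := Real.one_lt_rpow one_lt_two (by linarith)
    have hr1' := sub_pos.2 hr1
    refine ⟨b * (r / (r - 1)) + 2 ^ s, by positivity, fun n hn => ⟨Nat.log (2 ^ d) n, ?_⟩⟩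
    have hn0 : (0 : ℝ) < n := by exact_mod_cast (by omega : 0 < n)
    rw [rate, if_neg (by linarith), if_neg hgt.ne, add_mul]
    refine add_le_add ((hsum n _).trans ?_) (half_pow_log_rpow_le hd hs0.le (by omega))
    rw [mul_assoc]
    refine mul_le_mul_of_nonneg_left ?_ hb0.le
    have h2 : ((2 : ℝ) ^ d) ^ Nat.log (2 ^ d) n ≤ n := by
      exact_mod_cast Nat.pow_log_le_self (2 ^ d) (by omega : n ≠ 0)
    set J := Nat.log (2 ^ d) n
    have hexp : 0 ≤ 1 / 2 - s / d := by
      rw [sub_nonneg, div_le_iff₀ hd0]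
      linarith
    -- `r ^ J` equals `(2 ^ (d * J)) ^ (1 / 2 - s / d)`, and the exponent is nonnegative in this
    -- regime.
    have hrJ : r ^ J ≤ (n : ℝ) ^ (1 / 2 - s / d) := by
      refine le_trans (le_of_eq ?_) (Real.rpow_le_rpow (by positivity) h2 hexp)
      rw [hr, ← Real.rpow_natCast, ← Real.rpow_natCast, ← Real.rpow_natCast,
        ← Real.rpow_mul zero_le_two, ← Real.rpow_mul zero_le_two, ← Real.rpow_mul zero_le_two]
      congr 1
      field_simp
    have hgeom : ∑ j ∈ Finset.range (J + 1), r ^ j ≤ r / (r - 1) * r ^ J := by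
      rw [geom_sum_eq hr1.ne', div_mul_eq_mul_div]
      refine div_le_div_of_nonneg_right ?_ hr1'.le
      rw [pow_succ']
      linarith
    rw [div_le_iff₀ (Real.sqrt_pos.2 hn0), mul_assoc]
    refine hgeom.trans (mul_le_mul_of_nonneg_left (hrJ.trans_eq ?_) (by positivity))
    rw [Real.sqrt_eq_rpow, one_div (_ ^ (s / d)), ← Real.rpow_neg hn0.le, ← Real.rpow_add hn0]
    congr 1
    ring

theorem theoremC (d : ℕ) (s : ℝ) (hs : 1 ≤ s) :
    ∃ C : ℝ, 0 < C ∧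
      ∀ (μ : Measure (EuclideanSpace ℝ (Fin d))) [IsProbabilityMeasure μ],
        μ (unitCube d) = 1 →
      ∀ {Ω : Type*} [MeasurableSpace Ω] (P : Measure Ω) [IsProbabilityMeasure P]
        (X : ℕ → Ω → EuclideanSpace ℝ (Fin d)),
        (∀ k, Measurable (X k)) → iIndepFun X P → (∀ k, P.map (X k) = μ) →
      ∀ n : ℕ, 2 ≤ n →
        Measurable (fun ω => dualDist (csUnitBall d s) (empiricalMeasure (fun k => X k ω) n) μ) ∧
        ∫⁻ ω, dualDist (csUnitBall d s) (empiricalMeasure (fun k => X k ω) n) μ ∂P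
          ≤ ENNReal.ofReal (C * rate d s n) := by
  obtain ⟨C₁, hC₁, h₁⟩ := exists_lintegral_dualDist_le d hs
  obtain ⟨C₂, hC₂, h₂⟩ := exists_scale_sum_le_rate d hs
  -- `C₁` may vanish; adding 1 makes the constant positive.
  refine ⟨(C₁ + 1) * C₂, by positivity, fun μ _ hμ Ω _ P _ X hX hind hlaw n hn => ⟨?_, ?_⟩⟩
  · exact measurable_dualDist_empiricalMeasure (fun f hf => hf.1.continuous) μ hX n
  · obtain ⟨J, hJ⟩ := h₂ n hn
    refine (h₁ μ hμ P X hX hind hlaw n (by omega) J).trans (ENNReal.ofReal_le_ofReal ?_)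
    rw [mul_assoc]
    refine mul_le_mul (le_add_of_nonneg_right zero_le_one) hJ ?_ (by positivity)
    exact add_nonneg (Finset.sum_nonneg fun j _ => by positivity) (by positivity)
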